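/- Let $k$ be a field of characteristic $p>0$, let $G$ be a finite group of order $p^n$ (so $n=\log_p|G|$), and let all $k$-algebras be commutative. A $k$-$G$-algebra is a $k$-algebra $A$ on which $G$ acts by $k$-algebra automorphisms; $A^G$ denotes its ring of invariants and $\mathrm{tr}(a)=\sum_{g\in G} g a$ its trace map. Let $\mathfrak{Ts}$ be the category of $k$-$G$-algebras $A$ that are finitely generated over $k$ and satisfy $\mathrm{tr}(A)=A^G$. Tensor products of $k$-$G$-algebras carry the diagonal action, and $R^{[m]}$ denotes the polynomial ring in $m$ variables over $R$. A polynomial ring $P$ in finitely many variables over $k$ with faithful $G$-action by $k$-algebra automorphisms is called triangular if it has polynomial generators $T_1,\dots,T_m$ (that is, $P=k[T_1,\dots,T_m]\cong k^{[m]}$) with $gT_i-T_i\in k[T_1,\dots,T_{i-1}]$ for all $g\in G$ and all $i$. A $k$-$G$-algebra $E$ of finite Krull dimension $N$ is called erasable if for every nonzero $A\in\mathfrak{Ts}$ there are $\lambda_1,\dots,\lambda_N\in (A\otimes_k E)^G$ such that $A\otimes_k E=(A\otimes_k 1)[\lambda_1,\dots,\lambda_N]$ is a polynomial ring over $A$ in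 $\lambda_1,\dots,\lambda_N$, that is, $\cong A^{[N]}$ by an isomorphism which is the identity on $A$. **Theorem.** Let $\Gamma\in\mathfrak{Ts}$ be erasable and of Krull dimension $d$, where $d$ is a non-negative integer. Then, as $k$-algebras, $$\Gamma\cong k^{[d]}\qquad\text{and}\qquad \Gamma^G\otimes_k k^{[n]}\cong k^{[n+d]}.$$ Moreover: 1. $\Gamma$ is $n$-stably triangular: the polynomial extension $\Gamma\otimes_k k^{[n]}$, with $G$ acting trivially on $k^{[n]}$, is a polynomial ring over $k$ in finitely many variables and its $G$-action is triangular. 2. $\Gamma^G$ is $n$-stably polynomial: $\Gamma^G\otimes_k k^{[n]}\cong k^{[N]}$ for some $N\in\mathbb{N}$. -/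

import Mathlib

open scoped TensorProduct

universe u v w x

/-! A `k`-`G`-algebra is a commutative `k`-algebra `A` together with a homomorphism
`ρ : G →* (A ≃ₐ[k] A)`, i.e. an action of `G` on `A` by `k`-algebra automorphisms. -/

namespace GAlg

section Actions

variable {k : Type u} {G : Type w} {A : Type v} {B : Type x} [Field k] [Group G]
  [CommRing A] [Algebra k A] [CommRing B] [Algebra k B]

/-- The ring of invariants `A^G`, as a `k`-subalgebra of `A`. -/
def invariants (ρ : G →* (A ≃ₐ[k] A)) : Subalgebra k A where
  carrier := {a | ∀ g : G, ρ g a = a}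
  mul_mem' := fun ha hb g => by rw [map_mul, ha g, hb g]
  add_mem' := fun ha hb g => by rw [map_add, ha g, hb g]
  algebraMap_mem' := fun c g => (ρ g).commutes c

/-- The trace (transfer) map `a ↦ ∑ g, g a`. -/
def trace [Fintype G] (ρ : G →* (A ≃ₐ[k] A)) (a : A) : A := ∑ g : G, ρ g a

/-- Membership in the category `𝔗𝔰` of finitely generated trace-surjective `k`-`G`-algebras:
`A` is a finitely generated `k`-algebra and `tr(A) = A^G`. -/
structure IsTs [Fintype G] (ρ : G →* (A ≃ₐ[k] A)) : Prop where
  finiteType : Algebra.FiniteType k A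
  range_trace : Set.range (trace ρ) = (invariants ρ : Set A)

/-- The diagonal action `g (a ⊗ b) = g a ⊗ g b` of `G` on `A ⊗[k] B`. -/
def tensor (ρ : G →* (A ≃ₐ[k] A)) (σ : G →* (B ≃ₐ[k] B)) :
    G →* ((A ⊗[k] B) ≃ₐ[k] (A ⊗[k] B)) where
  toFun g := Algebra.TensorProduct.congr (ρ g) (σ g)
  map_one' := by
    apply AlgEquiv.coe_toAlgHom_injective
    ext <;> simp
  map_mul' g h := by
    apply AlgEquiv.coe_toAlgHom_injective
    ext <;> simp

/-- The action of `G` on `A` is triangular: `G` acts faithfully, and `A` is a polynomial ring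
`k[T₁, …, Tₘ]` for some generators `Tᵢ` such that `g Tᵢ - Tᵢ ∈ k[T₁, …, Tᵢ₋₁]` for all
`g` and `i`. -/
def IsTriangular (ρ : G →* (A ≃ₐ[k] A)) : Prop :=
  Function.Injective ρ ∧
    ∃ (m : ℕ) (φ : MvPolynomial (Fin m) k ≃ₐ[k] A), ∀ (g : G) (i : Fin m),
      ρ g (φ (MvPolynomial.X i)) - φ (MvPolynomial.X i) ∈
        Algebra.adjoin k ((fun j : Fin m => φ (MvPolynomial.X j)) '' {j | j < i})

/-- `A` is `m`-stably triangular: the action of `G` on `A ⊗[k] k[T₁, …, Tₘ]`, where `G` fixes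
`k[T₁, …, Tₘ]` pointwise, is triangular (so `A ⊗[k] k[T₁, …, Tₘ]` is a polynomial ring). -/
def IsStablyTriangular (m : ℕ) (ρ : G →* (A ≃ₐ[k] A)) : Prop :=
  IsTriangular (tensor ρ (1 : G →* (MvPolynomial (Fin m) k ≃ₐ[k] MvPolynomial (Fin m) k)))

variable (k) in
/-- The `k`-algebra `A` is `m`-stably polynomial: `A ⊗[k] k[T₁, …, Tₘ]` is a polynomial ring
over `k` in finitely many variables. -/
def IsStablyPolynomial (m : ℕ) (A : Type v) [CommRing A] [Algebra k A] : Prop :=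
  ∃ N : ℕ, Nonempty ((A ⊗[k] MvPolynomial (Fin m) k) ≃ₐ[k] MvPolynomial (Fin N) k)

/-- The `k`-`G`-algebra `E` is erasable: it has a finite Krull dimension `N` and, for every
`A ∈ 𝔗𝔰`, there are `G`-invariant elements `λ₁, …, λ_N` of `A ⊗[k] E` such that
`A ⊗[k] E = A[λ₁, …, λ_N]` is a polynomial ring over `A` in the `λᵢ`
(the isomorphism being the identity on `A`; for `A ≠ 0` it restricts to
`k[T₁, …, T_N] ≅ k[λ₁, …, λ_N]`, and for `A = 0` there is no condition).
As `k : Type u`, every finitely generated `k`-algebra is isomorphic to one in `Type u`, so that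
quantifying over `A : Type u` covers all of `𝔗𝔰`. -/
def IsErasable [Fintype G] {E : Type v} [CommRing E] [Algebra k E]
    (σ : G →* (E ≃ₐ[k] E)) : Prop :=
  ∃ N : ℕ, ringKrullDim E = N ∧
    ∀ (A : Type u) [CommRing A] [Algebra k A] (ρ : G →* (A ≃ₐ[k] A)), IsTs ρ →
      ∃ φ : MvPolynomial (Fin N) A ≃ₐ[A] (A ⊗[k] E),
        ∀ i : Fin N, φ (MvPolynomial.X i) ∈ invariants (tensor ρ σ)

end Actions

end GAlg

/-! Compute one algebra in two ways. For `G` of order `p ^ n` there is a triangular polynomial ring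
`P` in `n` variables that lies in `𝔗𝔰` and whose invariants are again polynomial
(`exists_triangular_model`). It is built by induction on `n`: a central `z` of order `p` is split
off, and one variable with `z X = X + 1` is adjoined to the model of `G / ⟨z⟩`, as in Artin-Schreier
theory.

An element of trace one turns additive cocycles into coboundaries, so the triangular variables of
`P` can be corrected to invariant ones over `Γ`: `Γ ⊗ P = Γ[n invariant variables]`
(`HasTriangularCoordinates.exists_invariant_coordinates`). Erasability of `Γ` gives `P ⊗ Γ = P[d
invariant variables]`. Taking invariants on both sides yields `Γ^G[n] ≅ P^G[d] ≅ k^[n+d]`.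
Specialising `P` at a rational point yields `Γ ≅ k^[d]`. Finally `Γ ⊗ k^[n] ≅ P[d invariant
variables]` equivariantly, which is triangular because `P` is. -/

namespace GAlg

/-! ### Trace-one elements, cocycles and power sums modulo `p`. -/

section Cohomology

variable {k : Type u} {G : Type w} {A : Type v} [Field k] [Group G] [CommRing A] [Algebra k A]

theorem mem_invariants {ρ : G →* (A ≃ₐ[k] A)} {a : A} :
    a ∈ invariants ρ ↔ ∀ g, ρ g a = a :=
  Iff.rfl

theorem apply_mul (ρ : G →* (A ≃ₐ[k] A)) (g h : G) (a : A) : ρ (g * h) a = ρ g (ρ h a) := by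
  rw [map_mul]; rfl

theorem apply_trace [Fintype G] (ρ : G →* (A ≃ₐ[k] A)) (h : G) (a : A) :
    ρ h (trace ρ a) = trace ρ a := by
  simp only [trace, map_sum, ← apply_mul]
  exact Fintype.sum_equiv (Equiv.mulLeft h) _ _ fun _ => rfl

theorem IsTs.exists_trace_eq_one [Fintype G] {ρ : G →* (A ≃ₐ[k] A)} (h : IsTs ρ) :
    ∃ θ, trace ρ θ = 1 := by
  have : (1 : A) ∈ Set.range (trace ρ) := by
    rw [h.range_trace]; exact one_mem _
  exact this

/-- The trace is linear over the invariants, so an invariant `a` is the trace of `a * θ`. -/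
theorem isTs_of_trace_eq_one [Fintype G] {ρ : G →* (A ≃ₐ[k] A)} (hA : Algebra.FiniteType k A)
    {θ : A} (hθ : trace ρ θ = 1) : IsTs ρ where
  finiteType := hA
  range_trace := by
    ext a
    constructor
    · rintro ⟨b, rfl⟩ h
      exact apply_trace ρ h b
    · intro ha
      refine ⟨a * θ, ?_⟩
      have : ∀ g, ρ g a = a := ha
      simp only [trace, map_mul, this, ← Finset.mul_sum]
      rw [← trace, hθ, mul_one]

/-- In the presence of an element of trace one, additive `1`-cocycles are coboundaries. -/
theorem apply_sum_cocycle [Fintype G] (ρ : G →* (A ≃ₐ[k] A)) {θ : A} (hθ : trace ρ θ = 1)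
    {c : G → A} (hc : ∀ g h, c (g * h) = c g + ρ g (c h)) (h : G) :
    ρ h (∑ g, c g * ρ g θ) = (∑ g, c g * ρ g θ) - c h := by
  have h1 : ρ h (∑ g, c g * ρ g θ) = ∑ g, (c (h * g) - c h) * ρ (h * g) θ := by
    simp only [map_sum, map_mul, hc, add_sub_cancel_left]
    rfl
  rw [h1, show ∑ g, (c (h * g) - c h) * ρ (h * g) θ = ∑ g, (c g - c h) * ρ g θ from
    Fintype.sum_equiv (Equiv.mulLeft h) _ _ fun _ => rfl]
  simp only [sub_mul, Finset.sum_sub_distrib, ← Finset.mul_sum]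
  rw [← trace, hθ, mul_one]

theorem sum_eq_sum_quotient_zpowers {M : Type*} [AddCommMonoid M] [Fintype G] (z : G)
    [Fintype (G ⧸ Subgroup.zpowers z)] (F : G → M) :
    ∑ g, F g = ∑ q : G ⧸ Subgroup.zpowers z, ∑ i : Fin (orderOf z), F (q.out * z ^ (i : ℕ)) := by
  classical
  have hb : Function.Bijective fun x : (G ⧸ Subgroup.zpowers z) × Fin (orderOf z) =>
      x.1.out * z ^ (x.2 : ℕ) := by
    constructor
    · rintro ⟨q, i⟩ ⟨r, j⟩ h
      simp only at h
      have hqr : q = r := by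
        have := congrArg (QuotientGroup.mk (s := Subgroup.zpowers z)) h
        rwa [QuotientGroup.mk_mul_of_mem _ (Subgroup.npow_mem_zpowers z _),
          QuotientGroup.mk_mul_of_mem _ (Subgroup.npow_mem_zpowers z _),
          QuotientGroup.out_eq', QuotientGroup.out_eq'] at this
      subst hqr
      have hij : (i : ℕ) = j := pow_injOn_Iio_orderOf i.2 j.2 (mul_left_cancel h)
      rw [Fin.ext hij]
    · intro g
      have hg : (QuotientGroup.mk (s := Subgroup.zpowers z) g).out⁻¹ * g ∈ Subgroup.zpowers z :=
        QuotientGroup.eq.1 (QuotientGroup.out_eq' _)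
      rw [mem_zpowers_iff_mem_range_orderOf, Finset.mem_image] at hg
      obtain ⟨i, hi, h⟩ := hg
      refine ⟨(QuotientGroup.mk g, ⟨i, Finset.mem_range.1 hi⟩), ?_⟩
      simp only [h, mul_inv_cancel_left]
  rw [← hb.sum_comp, Fintype.sum_prod_type]

/-- A `p`-group acts faithfully on a nonzero algebra in characteristic `p` which has an element
of trace one. -/
theorem injective_of_trace_eq_one {p n : ℕ} [Fact p.Prime] [CharP k p] [Fintype G] [Nontrivial A]
    (hG : Fintype.card G = p ^ n) {ρ : G →* (A ≃ₐ[k] A)} {θ : A} (hθ : trace ρ θ = 1) :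
    Function.Injective ρ := by
  classical
  rw [injective_iff_map_eq_one]
  intro z hz
  by_contra hne
  have : CharP A p := charP_of_injective_algebraMap (algebraMap k A).injective p
  have hcard : (orderOf z : A) = 0 := by
    rw [CharP.cast_eq_zero_iff A p]
    have hd : orderOf z ∣ p ^ n := hG ▸ orderOf_dvd_card
    obtain ⟨m, -, hm⟩ := (Nat.dvd_prime_pow Fact.out).1 hd
    rw [hm]
    refine dvd_pow_self p ?_
    rintro rfl
    exact hne (orderOf_eq_one_iff.1 (by simpa using hm))
  have : trace ρ θ = 0 := by
    -- If `z` acts trivially, each coset of `⟨z⟩` contributes one value `orderOf z` times, hence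
    -- zero.
    rw [trace, sum_eq_sum_quotient_zpowers z]
    simp [hz, hcard]
  exact one_ne_zero (hθ.symm.trans this)

/-- A function `t` on `G` which counts the powers of `z`, modulo the characteristic. -/
theorem exists_index (p : ℕ) [CharP k p] (z : G)
    (hp : orderOf z = p) : ∃ t : G → k, ∀ (i : ℤ) (g : G), t (g * z ^ i) = i + t g := by
  have hex : ∀ g : G, ∃ i : ℤ, z ^ i = (QuotientGroup.mk (s := Subgroup.zpowers z) g).out⁻¹ * g :=
    fun g => Subgroup.mem_zpowers_iff.1 (QuotientGroup.eq.1 (QuotientGroup.out_eq' _))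
  choose t ht using hex
  -- The exponent of `z` relative to the coset representative is defined modulo `orderOf z = p`, so
  -- its image in `k` is well behaved.
  refine ⟨fun g => (t g : k), fun i g => ?_⟩
  rw [← Int.cast_add, CharP.intCast_eq_intCast k p, ← hp, ← zpow_eq_zpow_iff_modEq, ht, add_comm,
    zpow_add, ht, QuotientGroup.mk_mul_of_mem _ (Subgroup.zpow_mem_zpowers z _), mul_assoc]

/-- Given an algebra with an element of trace one for `G / ⟨z⟩`, where `z` is central of order
`p`, there is a `1`-cocycle of `G` which restricts to the standard homomorphism on `⟨z⟩`. -/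
theorem exists_cocycle (p : ℕ) [CharP k p] [Finite G] (z : G) (hz : z ∈ Subgroup.center G)
    (hp : orderOf z = p) [(Subgroup.zpowers z).Normal] [Fintype (G ⧸ Subgroup.zpowers z)]
    (ρ : G ⧸ Subgroup.zpowers z →* (A ≃ₐ[k] A)) {θ : A} (hθ : trace ρ θ = 1) :
    ∃ c : G → A, (∀ g h, c (g * h) = c g + ρ g (c h)) ∧ ∀ (i : ℕ) g, c (g * z ^ i) = i + c g := by
  obtain ⟨t, ht⟩ := exists_index (k := k) p z hp
  have hcomm : ∀ (i : ℤ) (g : G), z ^ i * g = g * z ^ i := fun i g =>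
    (Subgroup.mem_center_iff.1 (zpow_mem hz i) g).symm
  -- The failure of `t` to be additive is a 2-cocycle that descends to `G / ⟨z⟩`, as `z` is central.
  let f : G → G → k := fun g h => t (g * h) - t g - t h
  have hfr : ∀ g h (i : ℤ), f g (h * z ^ i) = f g h := fun g h i => by
    simp only [f, ← mul_assoc, ht]; ring
  have hfl : ∀ g h (i : ℤ), f (g * z ^ i) h = f g h := fun g h i => by
    simp only [f, mul_assoc, hcomm]
    simp only [← mul_assoc, ht]; ring
  have hout : ∀ g : G, ∃ i : ℤ, (QuotientGroup.mk (s := Subgroup.zpowers z) g).out = g * z ^ i :=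
    fun g => by
      obtain ⟨⟨_, i, rfl⟩, hi⟩ := QuotientGroup.mk_out_eq_mul (Subgroup.zpowers z) g
      exact ⟨i, hi⟩
  have hfo : ∀ g h : G, f g (QuotientGroup.mk (s := Subgroup.zpowers z) h).out = f g h :=
    fun g h => by
      obtain ⟨i, hi⟩ := hout h
      rw [hi, hfr]
  have hcoc : ∀ g h l, f (g * h) l = f g (h * l) + f h l - f g h := fun g h l => by
    simp only [f, mul_assoc]; ring
  -- Averaging `f` against `θ` trivialises it over `A`; thus `t + b` is a 1-cocycle, and `b` is
  -- blind to `z`.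
  let b : G → A := fun g => ∑ y : G ⧸ Subgroup.zpowers z,
    algebraMap k A (f g y.out) * ρ ((g : G ⧸ Subgroup.zpowers z) * y) θ
  have hbz : ∀ g (i : ℤ), b (g * z ^ i) = b g := fun g i => by
    simp only [b, hfl, QuotientGroup.mk_mul_of_mem _ (Subgroup.zpow_mem_zpowers z i)]
  have hsum : ∀ x : G ⧸ Subgroup.zpowers z, ∑ y, ρ (x * y) θ = 1 := fun x => by
    rw [← hθ]
    exact Fintype.sum_equiv (Equiv.mulLeft x) _ _ fun _ => rfl
  have hb : ∀ g h, b (g * h) = b g + ρ g (b h) - algebraMap k A (f g h) := fun g h => by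
    have h1 : b g = ∑ y : G ⧸ Subgroup.zpowers z, algebraMap k A (f g (h * y.out)) *
        ρ ((g : G ⧸ Subgroup.zpowers z) * h * y) θ := by
      symm
      refine Fintype.sum_equiv (Equiv.mulLeft (h : G ⧸ Subgroup.zpowers z)) _ _ fun y => ?_
      simp only [Equiv.coe_mulLeft, mul_assoc]
      congr 2
      rw [← hfo g (h * y.out), QuotientGroup.mk_mul, QuotientGroup.out_eq']
    have h2 : algebraMap k A (f g h) = ∑ y : G ⧸ Subgroup.zpowers z, algebraMap k A (f g h) *
        ρ ((g : G ⧸ Subgroup.zpowers z) * h * y) θ := by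
      rw [← Finset.mul_sum, hsum, mul_one]
    rw [h1, h2]
    simp only [b, map_sum, map_mul (ρ _), AlgEquiv.commutes, ← Finset.sum_add_distrib,
      ← Finset.sum_sub_distrib, QuotientGroup.mk_mul]
    refine Finset.sum_congr rfl fun y _ => ?_
    rw [hcoc, map_sub, map_add, mul_assoc, apply_mul, apply_mul]
    ring
  refine ⟨fun g => algebraMap k A (t g) + b g, fun g h => ?_, fun i g => ?_⟩
  · simp only [hb, map_add, AlgEquiv.commutes, f, map_sub]
    ring
  · have h1 := hbz g i
    have h2 := ht i g
    rw [zpow_natCast] at h1 h2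
    simp only [h1, h2, map_add, Int.cast_natCast, map_natCast, add_assoc]

theorem sum_fin_cast_pow {p : ℕ} [Fact p.Prime] [CharP A p] {m : ℕ} (hm : m ≤ p - 1) :
    ∑ i : Fin p, ((i : ℕ) : A) ^ m = if m = p - 1 then -1 else 0 := by
  classical
  have hp : 2 ≤ p := (Fact.out : p.Prime).two_le
  have hb : Function.Bijective fun i : Fin p => ((i : ℕ) : ZMod p) := by
    rw [Fintype.bijective_iff_injective_and_card]
    refine ⟨fun i j h => Fin.ext (CharP.natCast_injOn_Iio (ZMod p) p i.2 j.2 h), ?_⟩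
    rw [ZMod.card, Fintype.card_fin]
  have h1 : ∑ i : Fin p, ((i : ℕ) : A) ^ m = ZMod.castHom dvd_rfl A (∑ x : ZMod p, x ^ m) := by
    rw [← hb.sum_comp, map_sum]
    simp only [map_pow, map_natCast]
  rw [h1]
  split_ifs with h
  · subst h
    have h2 : ∀ x : ZMod p, x ^ (p - 1) = 1 - if x = 0 then 1 else 0 := fun x => by
      split_ifs with hx
      · rw [hx, zero_pow (by omega), sub_self]
      · rw [ZMod.pow_card_sub_one_eq_one hx, sub_zero]
    simp [h2]
  · rw [FiniteField.sum_pow_lt_card_sub_one, map_zero]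
    rw [ZMod.card]
    omega

/-- In the binomial expansion only the power sum of exponent `p - 1` survives. -/
theorem sum_fin_add_pow_pred {p : ℕ} [Fact p.Prime] [CharP A p] (a : A) :
    ∑ i : Fin p, ((i : ℕ) + a) ^ (p - 1) = -1 := by
  simp only [add_pow]
  rw [Finset.sum_comm]
  simp only [← Finset.sum_mul]
  rw [Finset.sum_eq_single (p - 1)]
  · simp [sum_fin_cast_pow le_rfl]
  · intro m hm hne
    have := Finset.mem_range.1 hm
    rw [sum_fin_cast_pow (by omega), if_neg hne, zero_mul, zero_mul]
  · simp

end Cohomology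

/-! ### Adjoining a variable along a cocycle, and the resulting invariants. -/

section Extension

open Polynomial

variable {k : Type u} {G : Type w} {A : Type v} [Field k] [Group G] [CommRing A] [Algebra k A]

/-- The endomorphism of `A[X]` given by `e` on `A` and by `X ↦ X + c`. -/
noncomputable def affineHom (e : A →ₐ[k] A) (c : A) : A[X] →ₐ[k] A[X] :=
  ((aeval (X + C c) : A[X] →ₐ[A] A[X]).restrictScalars k).comp (mapAlgHom e)

theorem affineHom_apply (e : A →ₐ[k] A) (c : A) (f : A[X]) :
    affineHom e c f = (f.map (e : A →+* A)).comp (X + C c) := by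
  simp only [affineHom, AlgHom.comp_apply, AlgHom.restrictScalars_apply, coe_mapAlgHom, comp,
    aeval_def]
  rfl

@[simp]
theorem affineHom_C (e : A →ₐ[k] A) (c a : A) : affineHom e c (C a) = C (e a) := by
  simp [affineHom_apply]

@[simp]
theorem affineHom_X (e : A →ₐ[k] A) (c : A) : affineHom e c X = X + C c := by
  simp [affineHom_apply]

/-- The action of `G` on `A[X]` which extends the action on `A` by `g X = X + c g`, for a
`1`-cocycle `c`. -/
noncomputable def extendAction (ρ : G →* (A ≃ₐ[k] A)) (c : G → A)
    (hc : ∀ g h, c (g * h) = c g + ρ g (c h)) : G →* (A[X] ≃ₐ[k] A[X]) :=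
  -- A monoid homomorphism out of a group lands in the units, so invertibility needs no separate
  -- check.
  (AlgEquiv.algHomUnitsEquiv k A[X]).toMonoidHom.comp <| MonoidHom.toHomUnits
    { toFun := fun g => affineHom (ρ g : A →ₐ[k] A) (c g)
      map_one' := by
        have h1 : c 1 = 0 := by simpa using hc 1 1
        refine Polynomial.algHom_ext' (AlgHom.ext fun a => ?_) ?_
        · simp [h1]
        · simp [h1]
      map_mul' := fun g h => by
        refine Polynomial.algHom_ext' (AlgHom.ext fun a => ?_) ?_
        · simp
        · simp [hc, add_assoc] }

variable (ρ : G →* (A ≃ₐ[k] A)) (c : G → A) (hc : ∀ g h, c (g * h) = c g + ρ g (c h))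

theorem extendAction_apply (g : G) (f : A[X]) :
    extendAction ρ c hc g f = (f.map (ρ g : A →+* A)).comp (X + C (c g)) :=
  affineHom_apply _ _ f

@[simp]
theorem extendAction_C (g : G) (a : A) : extendAction ρ c hc g (C a) = C (ρ g a) :=
  affineHom_C _ _ a

@[simp]
theorem extendAction_X (g : G) : extendAction ρ c hc g X = X + C (c g) :=
  affineHom_X _ _

theorem natDegree_extendAction_le (g : G) (f : A[X]) :
    (extendAction ρ c hc g f).natDegree ≤ f.natDegree := by
  rw [extendAction_apply]
  refine natDegree_comp_le.trans ?_
  calc _ ≤ f.natDegree * 1 := Nat.mul_le_mul natDegree_map_le (natDegree_add_C.trans_le natDegree_X_le)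
    _ = _ := mul_one _

/-- A polynomial of degree less than the characteristic `p` which is invariant under `X ↦ X + 1`
is constant. -/
theorem eq_C_of_comp_X_add_one [IsDomain A] (p : ℕ) [CharP A p] {f : A[X]}
    (hf : f.comp (X + 1) = f) (hd : f.natDegree < p) : f = C (f.eval 0) := by
  have h1 : ∀ i : ℕ, f.eval (i : A) = f.eval 0 := fun i => by
    induction i with
    | zero => simp
    | succ i ih =>
      conv_rhs => rw [← ih, ← hf]
      simp
  rw [← sub_eq_zero]
  refine eq_zero_of_natDegree_lt_card_of_eval_eq_zero _ (ι := Fin p) (f := fun i => ((i : ℕ) : A))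
    (fun i j h => Fin.ext (CharP.natCast_injOn_Iio A p i.2 j.2 h)) (fun i => ?_) ?_
  · simp [h1]
  · rw [Fintype.card_fin, natDegree_sub_C]
    exact hd

/-- The invariants of an Artin-Schreier extension `A[X]`, where `z` fixes `A` and moves `X` to
`X + 1`, are generated over the invariants of `A` by an invariant of the form `X ^ p - X + b`. -/
theorem exists_comp_eq_of_invariant [IsDomain A] {p : ℕ} [Fact p.Prime] [CharP A p] {z : G}
    (hz : ρ z = 1) (hcz : c z = 1) {y : A[X]} (hy : y.Monic) (hdeg : y.natDegree = p)
    (hyi : y ∈ invariants (extendAction ρ c hc)) (n : ℕ) :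
    ∀ f ∈ invariants (extendAction ρ c hc), f.natDegree < n →
      ∃ h : (invariants ρ)[X], (h.map (invariants ρ).val.toRingHom).comp y = f := by
  have hp : 2 ≤ p := (Fact.out : p.Prime).two_le
  induction n with
  | zero => intro f _ h; omega
  | succ n ih =>
    intro f hf hn
    have hdm := modByMonic_add_div f y
    have hlt : (f %ₘ y).natDegree < p := by
      rw [← hdeg]
      exact natDegree_modByMonic_lt f hy (by rintro rfl; simp at hdeg; omega)
    -- The action fixes `f` and `y` and does not raise degrees, so uniqueness of division by `y`
    -- makes quotient and remainder invariant.
    have hinv : ∀ g, extendAction ρ c hc g (f /ₘ y) = f /ₘ y ∧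
        extendAction ρ c hc g (f %ₘ y) = f %ₘ y := fun g => by
      have h := div_modByMonic_unique (f := f) (extendAction ρ c hc g (f /ₘ y))
        (extendAction ρ c hc g (f %ₘ y)) hy ⟨?_, ?_⟩
      · exact ⟨h.1.symm, h.2.symm⟩
      · have := congrArg (extendAction ρ c hc g) hdm
        rwa [map_add, map_mul, hyi g, hf g] at this
      · refine degree_lt_degree ((natDegree_extendAction_le ρ c hc g _).trans_lt ?_)
        rwa [hdeg]
    have hr : f %ₘ y = C ((f %ₘ y).eval 0) := by
      refine eq_C_of_comp_X_add_one p ?_ hlt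
      have := (hinv z).2
      rw [extendAction_apply, hz, hcz, C_1] at this
      conv_rhs => rw [← this]
      congr 1
      exact Polynomial.map_id.symm
    have hri : (f %ₘ y).eval 0 ∈ invariants ρ := fun g => by
      have := (hinv g).2
      rw [hr, extendAction_C] at this
      exact C_injective this
    by_cases hfd : f.natDegree < p
    · have : f %ₘ y = f := (modByMonic_eq_self_iff hy).2 (degree_lt_degree (hdeg.symm ▸ hfd))
      refine ⟨C ⟨_, hri⟩, ?_⟩
      rw [map_C, C_comp]
      exact hr.symm.trans this
    · obtain ⟨h, hh⟩ := ih (f /ₘ y) (fun g => (hinv g).1) (by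
        rw [natDegree_divByMonic f hy]; omega)
      refine ⟨C ⟨_, hri⟩ + X * h, ?_⟩
      conv_rhs => rw [← hdm]
      rw [Polynomial.map_add, Polynomial.map_mul, map_C, map_X, add_comp, mul_comp, C_comp, X_comp,
        hh]
      conv_rhs => rw [hr]
      rfl

/-- Substituting `y` for the variable is injective since `y` is not constant, and surjective by
repeated division by `y`. -/
theorem nonempty_invariants_extendAction [IsDomain A] {p : ℕ} [Fact p.Prime]
    [CharP A p] {z : G} (hz : ρ z = 1) (hcz : c z = 1) {y : A[X]} (hy : y.Monic)
    (hdeg : y.natDegree = p) (hyi : y ∈ invariants (extendAction ρ c hc)) :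
    Nonempty ((invariants ρ)[X] ≃ₐ[k] invariants (extendAction ρ c hc)) := by
  have hp : 2 ≤ p := (Fact.out : p.Prime).two_le
  let F : (invariants ρ)[X] →ₐ[k] A[X] :=
    ((aeval y : A[X] →ₐ[A] A[X]).restrictScalars k).comp (mapAlgHom (invariants ρ).val)
  have hF : ∀ h, F h = (h.map (invariants ρ).val.toRingHom).comp y := fun h => rfl
  have hFi : ∀ h, F h ∈ invariants (extendAction ρ c hc) := fun h => by
    induction h using Polynomial.induction_on' with
    | add p q hp hq => rw [map_add]; exact add_mem hp hq
    | monomial n a =>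
      rw [hF, map_monomial, monomial_comp]
      refine mul_mem (fun g => ?_) (pow_mem hyi n)
      rw [extendAction_C]
      exact congrArg C (a.2 g)
  refine ⟨AlgEquiv.ofBijective (F.codRestrict _ hFi) ⟨?_, ?_⟩⟩
  · rw [AlgHom.injective_codRestrict, injective_iff_map_eq_zero]
    intro h hh
    rw [hF, comp_eq_zero_iff] at hh
    rcases hh with hh | ⟨-, hh⟩
    · exact (Polynomial.map_eq_zero_iff Subtype.val_injective).1 hh
    · rw [hh, natDegree_C] at hdeg
      omega
  · rintro ⟨f, hf⟩
    obtain ⟨h, hh⟩ := exists_comp_eq_of_invariant ρ c hc hz hcz hy hdeg hyi _ f hf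
      (Nat.lt_succ_self _)
    exact ⟨h, Subtype.ext hh⟩

end Extension

/-! ### Transport and extension of triangular coordinates. -/

section Triangular

open MvPolynomial

variable {k : Type u} {G : Type w} {A : Type v} {B : Type x} [Field k] [Group G]
  [CommRing A] [Algebra k A] [CommRing B] [Algebra k B]

/-- The algebra `A` is a polynomial ring in `m` variables on which `G` acts triangularly
(but not necessarily faithfully). -/
def HasTriangularCoordinates (ρ : G →* (A ≃ₐ[k] A)) (m : ℕ) : Prop :=
  ∃ φ : MvPolynomial (Fin m) k ≃ₐ[k] A, ∀ (g : G) (i : Fin m),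
    ρ g (φ (X i)) - φ (X i) ∈ Algebra.adjoin k ((fun j : Fin m => φ (X j)) '' {j | j < i})

theorem HasTriangularCoordinates.comp {H : Type*} [Group H] {ρ : G →* (A ≃ₐ[k] A)} {m : ℕ}
    (h : HasTriangularCoordinates ρ m) (π : H →* G) :
    HasTriangularCoordinates (ρ.comp π) m := by
  obtain ⟨φ, hφ⟩ := h
  exact ⟨φ, fun g => hφ (π g)⟩

theorem HasTriangularCoordinates.congr {ρ : G →* (A ≃ₐ[k] A)} {σ : G →* (B ≃ₐ[k] B)} {m : ℕ}
    (h : HasTriangularCoordinates ρ m) (e : A ≃ₐ[k] B) (he : ∀ g a, e (ρ g a) = σ g (e a)) :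
    HasTriangularCoordinates σ m := by
  obtain ⟨φ, hφ⟩ := h
  refine ⟨φ.trans e, fun g i => ?_⟩
  have h1 := (Subalgebra.mem_map (f := (e : A →ₐ[k] B))).2 ⟨_, hφ g i, rfl⟩
  rw [AlgHom.map_adjoin, Set.image_image] at h1
  simpa [he] using h1

/-- Triangular coordinates of `A` and of a polynomial ring `B` over `A` whose variables are
moved by elements of `A` combine to triangular coordinates of `B`. -/
theorem HasTriangularCoordinates.extend {ρ : G →* (A ≃ₐ[k] A)} {σ : G →* (B ≃ₐ[k] B)} {m d : ℕ}
    (h : HasTriangularCoordinates ρ m) [Algebra A B] [IsScalarTower k A B]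
    (ψ : MvPolynomial (Fin d) A ≃ₐ[A] B)
    (hσ : ∀ g a, σ g (algebraMap A B a) = algebraMap A B (ρ g a))
    (hψ : ∀ g j, ∃ a, σ g (ψ (X j)) - ψ (X j) = algebraMap A B a) :
    HasTriangularCoordinates σ (m + d) := by
  obtain ⟨φ, hφ⟩ := h
  let e : MvPolynomial (Fin (m + d)) k ≃ₐ[k] B :=
    -- The swap is needed because the coordinates of `A` come first in the order, while
    -- `sumAlgEquiv` makes the right summand the coefficients.
    (renameEquiv k (finSumFinEquiv.symm.trans (Equiv.sumComm (Fin m) (Fin d)))).trans <|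
      (sumAlgEquiv k (Fin d) (Fin m)).trans <|
        (mapAlgEquiv (Fin d) φ).trans (ψ.restrictScalars k)
  have el : ∀ i, e (X (Fin.castAdd d i)) = algebraMap A B (φ (X i)) := fun i => by
    simpa [e, sumAlgEquiv_X_inr] using ψ.commutes (φ (X i))
  have er : ∀ j, e (X (Fin.natAdd m j)) = ψ (X j) := fun j => by
    simp [e, sumAlgEquiv_X_inl]
  have hmap : ∀ (s : Set (Fin m)) (t : Set (Fin (m + d))), (∀ i ∈ s, Fin.castAdd d i ∈ t) →
      ∀ a ∈ Algebra.adjoin k ((fun j => φ (X j)) '' s),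
        algebraMap A B a ∈ Algebra.adjoin k ((fun j => e (X j)) '' t) := fun s t hst a ha => by
    have h1 := (Subalgebra.mem_map (f := IsScalarTower.toAlgHom k A B)).2 ⟨_, ha, rfl⟩
    rw [AlgHom.map_adjoin, Set.image_image] at h1
    refine Algebra.adjoin_mono ?_ h1
    rintro _ ⟨i, hi, rfl⟩
    exact ⟨_, hst i hi, el i⟩
  refine ⟨e, fun g i => ?_⟩
  refine Fin.addCases (fun i => ?_) (fun j => ?_) i
  · rw [el, hσ, ← map_sub]
    exact hmap _ _ (fun j hj => hj) _ (hφ g i)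
  · obtain ⟨a, ha⟩ := hψ g j
    rw [er, ha]
    refine hmap Set.univ _ (fun i _ => ?_) a ?_
    · simp [Fin.lt_def]; omega
    · have h1 := congrArg (Subalgebra.map (φ : MvPolynomial (Fin m) k →ₐ[k] A))
        (adjoin_range_X (R := k) (σ := Fin m))
      rw [AlgHom.map_adjoin, ← Set.range_comp, ← Set.image_univ, Algebra.map_top] at h1
      have h2 : a ∈ (φ : MvPolynomial (Fin m) k →ₐ[k] A).range := ⟨φ.symm a, by simp⟩
      rw [← h1] at h2
      exact h2

theorem IsStablyTriangular.of_hasTriangularCoordinates {n m : ℕ} {ρ : G →* (A ≃ₐ[k] A)}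
    (hρ : Function.Injective ρ)
    (h : HasTriangularCoordinates
      (tensor ρ (1 : G →* (MvPolynomial (Fin n) k ≃ₐ[k] MvPolynomial (Fin n) k))) m) :
    IsStablyTriangular n ρ := by
  refine ⟨fun g g' hg => hρ (AlgEquiv.ext fun a => ?_), m, h⟩
  refine Algebra.TensorProduct.includeLeft_injective (S := k) (R := k) (A := A)
    (B := MvPolynomial (Fin n) k) (C_injective _ _) ?_
  simpa [tensor] using DFunLike.congr_fun hg (a ⊗ₜ[k] (1 : MvPolynomial (Fin n) k))

end Triangular

/-! ### The triangular model `P` of a `p`-group. -/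

section Model

variable {k : Type u} {G : Type w} {A : Type v} [Field k] [Group G] [CommRing A] [Algebra k A]

open Polynomial

/-- Along a coset of `⟨z⟩` the variable runs through `X + c + i` for `i < p`, whose `(p - 1)`-th
powers sum to `-1`; what remains is the trace of `θ` over the quotient. -/
theorem trace_extendAction {p : ℕ} [Fact p.Prime] [CharP k p] [Nontrivial A] [Fintype G] {z : G}
    (hp : orderOf z = p) [(Subgroup.zpowers z).Normal] [Fintype (G ⧸ Subgroup.zpowers z)]
    (ρ : G ⧸ Subgroup.zpowers z →* (A ≃ₐ[k] A)) {θ : A} (hθ : trace ρ θ = 1) (c : G → A)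
    (hc : ∀ g h, c (g * h) = c g + ρ.comp (QuotientGroup.mk' (Subgroup.zpowers z)) g (c h))
    (hcz : ∀ (i : ℕ) g, c (g * z ^ i) = i + c g) :
    trace (extendAction (ρ.comp (QuotientGroup.mk' (Subgroup.zpowers z))) c hc)
      (-(X ^ (p - 1) * C θ)) = 1 := by
  have : CharP A p := charP_of_injective_algebraMap (algebraMap k A).injective p
  rw [trace, sum_eq_sum_quotient_zpowers z]
  subst hp
  have h1 : ∀ (q : G ⧸ Subgroup.zpowers z) (i : ℕ),
      extendAction (ρ.comp (QuotientGroup.mk' (Subgroup.zpowers z))) c hc (q.out * z ^ i)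
        (-(X ^ (orderOf z - 1) * C θ)) =
      -((((i : ℕ) : A[X]) + (X + C (c q.out))) ^ (orderOf z - 1) * C (ρ q θ)) := fun q i => by
    rw [map_neg, map_mul, map_pow, extendAction_X, extendAction_C, hcz, MonoidHom.comp_apply,
      QuotientGroup.mk'_apply, QuotientGroup.mk_mul_of_mem _ (Subgroup.npow_mem_zpowers z i),
      QuotientGroup.out_eq', C_add, C_eq_natCast]
    ring
  simp only [h1, Finset.sum_neg_distrib, ← Finset.sum_mul, sum_fin_add_pow_pred, neg_one_mul,
    neg_neg]
  rw [← map_sum, ← trace, hθ, C_1]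

/-- `g` moves `X ^ p - X` by `c g ^ p - c g`. Since `i ^ p = i` for `i` in the prime field, this is
a cocycle of `G / ⟨z⟩`, hence cancelled by some `b` in `A`; the invariant is `X ^ p - X + b`. -/
theorem exists_artinSchreier_invariant {p : ℕ} [Fact p.Prime] [CharP k p] [Nontrivial A]
    {z : G} [(Subgroup.zpowers z).Normal] [Fintype (G ⧸ Subgroup.zpowers z)] [Finite G]
    (ρ : G ⧸ Subgroup.zpowers z →* (A ≃ₐ[k] A)) {θ : A} (hθ : trace ρ θ = 1) (c : G → A)
    (hc : ∀ g h, c (g * h) = c g + ρ.comp (QuotientGroup.mk' (Subgroup.zpowers z)) g (c h))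
    (hcz : ∀ (i : ℕ) g, c (g * z ^ i) = i + c g) :
    ∃ y ∈ invariants (extendAction (ρ.comp (QuotientGroup.mk' (Subgroup.zpowers z))) c hc),
      y.Monic ∧ y.natDegree = p := by
  have hA : CharP A p := charP_of_injective_algebraMap (algebraMap k A).injective p
  have hp2 : 2 ≤ p := (Fact.out : p.Prime).two_le
  let d : G ⧸ Subgroup.zpowers z → A := fun q => c q.out ^ p - c q.out
  have hd : ∀ g : G, d g = c g ^ p - c g := fun g => by
    obtain ⟨⟨s, hs⟩, hi⟩ := QuotientGroup.mk_out_eq_mul (Subgroup.zpowers z) g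
    obtain ⟨i, rfl⟩ := (mem_powers_iff_mem_zpowers).2 hs
    have h1 : ((i : ℕ) : A) ^ p = i := by
      have h2 := congrArg (ZMod.castHom dvd_rfl A) (ZMod.pow_card (p := p) (i : ZMod p))
      rwa [map_pow, map_natCast] at h2
    simp only [d, hi, hcz, add_pow_char, h1]
    ring
  have hdc : ∀ x y, d (x * y) = d x + ρ x (d y) := fun x y => by
    induction x using QuotientGroup.induction_on with | _ g
    induction y using QuotientGroup.induction_on with | _ h
    rw [← QuotientGroup.mk_mul, hd, hd, hd, hc, add_pow_char, map_sub, map_pow]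
    simp only [MonoidHom.comp_apply, QuotientGroup.mk'_apply]
    ring
  have hb := apply_sum_cocycle ρ hθ hdc
  set b := ∑ g, d g * ρ g θ
  have hdeg : (-X + C b : A[X]).degree < p := by
    refine degree_lt_degree ?_ |>.trans_eq (degree_X_pow p)
    rw [natDegree_X_pow, natDegree_add_C, natDegree_neg, natDegree_X]
    omega
  refine ⟨X ^ p + (-X + C b), fun g => ?_, monic_X_pow_add hdeg, ?_⟩
  · simp only [map_add, map_neg, map_pow, extendAction_X, extendAction_C, MonoidHom.comp_apply,
      QuotientGroup.mk'_apply, hb, hd, add_pow_char, map_sub]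
    ring
  · rw [natDegree_add_eq_left_of_degree_lt (by rwa [degree_X_pow]), natDegree_X_pow]

theorem invariants_comp_of_surjective {H : Type*} [Group H] (ρ : H →* (A ≃ₐ[k] A)) {π : G →* H}
    (hπ : Function.Surjective π) : invariants (ρ.comp π) = invariants ρ := by
  ext a
  refine ⟨fun h g => ?_, fun h g => h (π g)⟩
  obtain ⟨g, rfl⟩ := hπ g
  exact h g

/-- Every group of order `p ^ n` acts triangularly on a polynomial ring in `n` variables over a
field of characteristic `p`, in such a way that there is an element of trace one and the ring of
invariants is again a polynomial ring in `n` variables. -/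
theorem exists_triangular_model (k : Type u) [Field k] (p : ℕ) [Fact p.Prime] [CharP k p] (n : ℕ) :
    ∀ (G : Type w) [Group G] [Fintype G], Fintype.card G = p ^ n →
      ∃ (P : Type u) (_ : CommRing P) (_ : Algebra k P) (σ : G →* (P ≃ₐ[k] P)),
        HasTriangularCoordinates σ n ∧ (∃ θ, trace σ θ = 1) ∧
        Nonempty (invariants σ ≃ₐ[k] MvPolynomial (Fin n) k) := by
  induction n with
  | zero =>
    intro G _ _ hG
    have : Subsingleton G := Fintype.card_le_one_iff_subsingleton.1 (by simp [hG])
    refine ⟨k, inferInstance, inferInstance, 1, ⟨MvPolynomial.isEmptyAlgEquiv k (Fin 0),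
      fun g i => i.elim0⟩, ⟨1, ?_⟩, ⟨?_⟩⟩
    · simp [trace, hG]
    · have : invariants (1 : G →* (k ≃ₐ[k] k)) = ⊤ := by
        ext a; simp [mem_invariants]
      exact (Subalgebra.equivOfEq _ _ this).trans
        (Subalgebra.topEquiv.trans (MvPolynomial.isEmptyAlgEquiv k (Fin 0)).symm)
  | succ n ih =>
    intro G _ _ hG
    classical
    have hp1 : 1 < p := (Fact.out : p.Prime).one_lt
    have hpG : IsPGroup p G := IsPGroup.of_card (Nat.card_eq_fintype_card.trans hG)
    have : Nontrivial G := by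
      rw [← Fintype.one_lt_card_iff_nontrivial, hG]
      exact Nat.one_lt_pow (by omega) hp1
    have := hpG.center_nontrivial
    have hdvd : p ∣ Nat.card (Subgroup.center G) := by
      obtain ⟨m, hm, hcard⟩ := (hpG.to_subgroup _).nontrivial_iff_card.1 this
      rw [hcard]
      exact dvd_pow_self p hm.ne'
    obtain ⟨⟨z, hz⟩, hord⟩ := exists_prime_orderOf_dvd_card' p hdvd
    have hzp : orderOf z = p := by rwa [Subgroup.orderOf_mk] at hord
    have hnormal : (Subgroup.zpowers z).Normal := ⟨fun a ha g => by
      have hac : a ∈ Subgroup.center G := (Subgroup.zpowers_le.2 hz) ha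
      rwa [Subgroup.mem_center_iff.1 hac g, mul_inv_cancel_right]⟩
    have hcard : Fintype.card (G ⧸ Subgroup.zpowers z) = p ^ n := by
      have h1 := Subgroup.card_eq_card_quotient_mul_card_subgroup (Subgroup.zpowers z)
      rw [Nat.card_zpowers, hzp, Nat.card_eq_fintype_card, Nat.card_eq_fintype_card, hG,
        pow_succ] at h1
      exact (Nat.eq_of_mul_eq_mul_right (by omega) h1).symm
    obtain ⟨A, _, _, ρ, hρ, ⟨θ, hθ⟩, ⟨e⟩⟩ := ih _ hcard
    obtain ⟨c, hc', hcz⟩ := exists_cocycle p z hz hzp ρ hθ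
    let π := QuotientGroup.mk' (Subgroup.zpowers z)
    have hc : ∀ g h, c (g * h) = c g + ρ.comp π g (c h) := hc'
    have hdom : IsDomain A := by
      obtain ⟨φ, -⟩ := hρ
      exact φ.symm.toMulEquiv.isDomain _
    have : CharP A p := charP_of_injective_algebraMap (algebraMap k A).injective p
    obtain ⟨y, hyi, hy, hdeg⟩ := exists_artinSchreier_invariant ρ hθ c hc hcz
    obtain ⟨F⟩ := nonempty_invariants_extendAction (ρ.comp π) c hc (z := z) (by
        simp only [MonoidHom.comp_apply, π, QuotientGroup.mk'_apply]
        rw [(QuotientGroup.eq_one_iff z).2 (Subgroup.mem_zpowers z), map_one]) (by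
        have h0 : c 1 = 0 := by simpa using hc 1 1
        simpa [h0] using hcz 1 1) hy hdeg hyi
    refine ⟨A[X], inferInstance, inferInstance, extendAction (ρ.comp π) c hc, ?_,
      ⟨_, trace_extendAction hzp ρ hθ c hc hcz⟩, ⟨?_⟩⟩
    · refine (hρ.comp π).extend (MvPolynomial.uniqueAlgEquiv A (Fin 1)) (fun g a => ?_)
        fun g j => ⟨c g, ?_⟩
      · exact extendAction_C _ _ _ g a
      · simp [Polynomial.algebraMap_eq]
    · let e' : invariants (ρ.comp π) ≃ₐ[k] MvPolynomial (Fin n) k :=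
        (Subalgebra.equivOfEq _ _ (invariants_comp_of_surjective ρ
          (QuotientGroup.mk'_surjective _))).trans e
      exact F.symm.trans ((Polynomial.mapAlgEquiv e').trans
        (MvPolynomial.finSuccEquiv k n).symm |>.restrictScalars k)

end Model

/-! ### Invariant coordinates on tensor products. -/

section Coordinates

open MvPolynomial

variable {k : Type u} {G : Type w} {A : Type v} {B : Type x} [Field k] [Group G]
  [CommRing A] [Algebra k A] [CommRing B] [Algebra k B]

@[simp]
theorem tensor_tmul (ρ : G →* (A ≃ₐ[k] A)) (σ : G →* (B ≃ₐ[k] B)) (g : G) (a : A) (b : B) :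
    tensor ρ σ g (a ⊗ₜ b) = ρ g a ⊗ₜ σ g b :=
  rfl

theorem tensor_algebraMap (ρ : G →* (A ≃ₐ[k] A)) (σ : G →* (B ≃ₐ[k] B)) (g : G) (a : A) :
    tensor ρ σ g (algebraMap A (A ⊗[k] B) a) = algebraMap A (A ⊗[k] B) (ρ g a) := by
  simp [Algebra.TensorProduct.algebraMap_apply]

theorem trace_tensor_tmul_one [Fintype G] (ρ : G →* (A ≃ₐ[k] A)) (σ : G →* (B ≃ₐ[k] B)) {θ : A}
    (hθ : trace ρ θ = 1) : trace (tensor ρ σ) (θ ⊗ₜ 1) = 1 := by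
  simp only [trace, tensor_tmul, map_one, ← TensorProduct.sum_tmul]
  rw [← trace, hθ, Algebra.TensorProduct.one_def]

/-- A surjective endomorphism of a noetherian ring is injective. -/
theorem injective_of_surjective_ringHom [IsNoetherianRing A] (f : A →+* A)
    (hf : Function.Surjective f) : Function.Injective f := by
  -- The kernels of the iterates of `f` form an ascending chain, which stabilises.
  let K : ℕ →o Ideal A :=
    { toFun := fun n => RingHom.ker (f ^ n)
      monotone' := monotone_nat_of_le_succ fun n x hx => by
        rw [RingHom.mem_ker] at hx ⊢
        rw [pow_succ', RingHom.mul_def, RingHom.comp_apply, hx, map_zero] }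
  obtain ⟨n, hn⟩ := WellFoundedGT.monotone_chain_condition K
  rw [injective_iff_map_eq_zero]
  intro x hx
  obtain ⟨y, rfl⟩ := (RingHom.coe_pow f n ▸ hf.iterate n : Function.Surjective (f ^ n)) x
  have h1 : y ∈ K (n + 1) := by
    change (f ^ (n + 1)) y = 0
    rw [pow_succ', RingHom.mul_def, RingHom.comp_apply, hx]
  rw [← hn (n + 1) n.le_succ] at h1
  exact h1

/-- A surjective homomorphism of `A`-algebras `A[X₁, …, Xₙ] → B`, where `B` is isomorphic to
`A[X₁, …, Xₙ]` and `A` is noetherian, is bijective. -/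
theorem bijective_of_surjective_of_equiv [IsNoetherianRing A] [Algebra A B] {n : ℕ}
    (e : MvPolynomial (Fin n) A ≃ₐ[A] B) (f : MvPolynomial (Fin n) A →ₐ[A] B)
    (hf : Function.Surjective f) : Function.Bijective f := by
  have h1 : Function.Surjective ((e.symm : B →ₐ[A] MvPolynomial (Fin n) A).comp f) :=
    e.symm.surjective.comp hf
  have h2 := injective_of_surjective_ringHom
    ((e.symm : B →ₐ[A] MvPolynomial (Fin n) A).comp f).toRingHom h1
  exact ⟨Function.Injective.of_comp h2, hf⟩

/-- Triangular polynomial algebras become polynomial algebras on invariant variables after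
tensoring with a noetherian algebra having an element of trace one. -/
theorem HasTriangularCoordinates.exists_invariant_coordinates [Fintype G] [IsNoetherianRing A]
    (ρ : G →* (A ≃ₐ[k] A)) {θ : A} (hθ : trace ρ θ = 1) {σ : G →* (B ≃ₐ[k] B)} {n : ℕ}
    (hσ : HasTriangularCoordinates σ n) :
    ∃ ψ : MvPolynomial (Fin n) A ≃ₐ[A] (A ⊗[k] B),
      ∀ i, ψ (X i) ∈ invariants (tensor ρ σ) := by
  obtain ⟨φ, hφ⟩ := hσ
  let e : MvPolynomial (Fin n) A ≃ₐ[A] (A ⊗[k] B) :=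
    (algebraTensorAlgEquiv k A).symm.trans (Algebra.TensorProduct.congr AlgEquiv.refl φ)
  let T : Fin n → A ⊗[k] B := fun i => 1 ⊗ₜ φ (X i)
  let c : Fin n → G → A ⊗[k] B := fun i g => tensor ρ σ g (T i) - T i
  -- `c i` is the cocycle by which `T i` moves, and `b i` moves by its negative, so `T i + b i` is
  -- invariant.
  let b : Fin n → A ⊗[k] B := fun i => ∑ g, c i g * tensor ρ σ g (θ ⊗ₜ 1)
  have hb : ∀ i h, tensor ρ σ h (b i) = b i - c i h := fun i h =>
    apply_sum_cocycle (tensor ρ σ) (trace_tensor_tmul_one ρ σ hθ) (fun g h => by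
      simp only [c, apply_mul, map_sub]; ring) h
  let f : MvPolynomial (Fin n) A →ₐ[A] A ⊗[k] B := aeval fun i => T i + b i
  -- By triangularity `b i` involves only the `T j` with `j < i`, so `T i` is recovered recursively
  -- from the new variables.
  have hT : ∀ i, T i ∈ f.range := fun i => by
    induction i using WellFoundedLT.induction with
    | ind i ih =>
    have hc : ∀ g, c i g ∈ f.range := fun g => by
      have h1 := (Subalgebra.mem_map (f := (Algebra.TensorProduct.includeRight :
        B →ₐ[k] A ⊗[k] B))).2 ⟨_, hφ g i, rfl⟩
      rw [AlgHom.map_adjoin, Set.image_image] at h1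
      have h2 : Algebra.adjoin k ((fun j => Algebra.TensorProduct.includeRight (φ (X j))) ''
          {j | j < i}) ≤ f.range.restrictScalars k := by
        refine Algebra.adjoin_le ?_
        rintro _ ⟨j, hj, rfl⟩
        exact ih j hj
      have h3 := h2 h1
      simpa [c, T, TensorProduct.tmul_sub] using h3
    have hbi : b i ∈ f.range := by
      refine sum_mem fun g _ => mul_mem (hc g) ?_
      rw [tensor_tmul, map_one]
      exact f.range.algebraMap_mem (ρ g θ)
    have h1 : T i + b i ∈ f.range := ⟨X i, aeval_X _ _⟩
    simpa using sub_mem h1 hbi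
  have hf : Function.Surjective f := by
    have h1 : ∀ q : MvPolynomial (Fin n) A, e q ∈ f.range := fun q => by
      have h2 : (e : MvPolynomial (Fin n) A →ₐ[A] A ⊗[k] B) = aeval T := by
        ext i
        simp [e, T]
      have h3 : e q = aeval T q := DFunLike.congr_fun h2 q
      have h4 : aeval T q ∈ (aeval T : MvPolynomial (Fin n) A →ₐ[A] A ⊗[k] B).range := ⟨q, rfl⟩
      rw [← Algebra.adjoin_range_eq_range_aeval] at h4
      rw [h3]
      exact Algebra.adjoin_le (Set.range_subset_iff.2 hT) h4
    intro a
    obtain ⟨q, rfl⟩ := e.surjective a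
    exact h1 q
  refine ⟨AlgEquiv.ofBijective f (bijective_of_surjective_of_equiv e f hf), fun i g => ?_⟩
  simp only [AlgEquiv.coe_ofBijective, f, aeval_X, map_add, hb, c]
  ring

/-- The invariants of a polynomial algebra on invariant variables. -/
theorem nonempty_mvPolynomial_invariants {ρ : G →* (A ≃ₐ[k] A)} {σ : G →* (B ≃ₐ[k] B)}
    [Algebra A B] [IsScalarTower k A B] {ι : Type*} (φ : MvPolynomial ι A ≃ₐ[A] B)
    (hσ : ∀ g a, σ g (algebraMap A B a) = algebraMap A B (ρ g a))
    (hφ : ∀ i, φ (X i) ∈ invariants σ) :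
    Nonempty (MvPolynomial ι (invariants ρ) ≃ₐ[k] invariants σ) := by
  -- As the variables are fixed, `G` acts on coefficients only: invariance is a coefficientwise
  -- condition.
  have hmap : ∀ g q, σ g (φ q) = φ (mapAlgHom (ρ g : A →ₐ[k] A) q) := fun g q => by
    induction q using MvPolynomial.induction_on with
    | C a =>
      have h1 : ∀ a, φ (C a) = algebraMap A B a := φ.commutes
      simp [h1, hσ]
    | add p q hp hq => simp only [map_add, hp, hq]
    | mul_X p i hp =>
      rw [map_mul, map_mul, hp, hφ i g, map_mul, map_mul]
      simp
  let F : MvPolynomial ι (invariants ρ) →ₐ[k] B :=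
    ((φ.restrictScalars k : MvPolynomial ι A ≃ₐ[k] B) : MvPolynomial ι A →ₐ[k] B).comp
      (mapAlgHom (invariants ρ).val)
  have hF : ∀ q, F q = φ (map (invariants ρ).val.toRingHom q) := fun q => rfl
  refine ⟨AlgEquiv.ofBijective (F.codRestrict (invariants σ) fun q g => ?_) ⟨?_, ?_⟩⟩
  · rw [hF, hmap]
    refine congrArg φ (MvPolynomial.ext _ _ fun m => ?_)
    change coeff m (map _ (map _ q)) = coeff m (map _ q)
    rw [coeff_map, coeff_map]
    exact (coeff m q).2 g
  · refine (AlgHom.injective_codRestrict _ _ _).2 ?_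
    exact φ.injective.comp (map_injective _ Subtype.val_injective)
  · rintro ⟨b, hb⟩
    obtain ⟨q, rfl⟩ := φ.surjective b
    have hq : q ∈ Set.range (map (invariants ρ).val.toRingHom) := by
      rw [mem_range_map_iff_coeffs_subset]
      intro a ha
      obtain ⟨m, -, rfl⟩ := mem_coeffs_iff.1 ha
      refine ⟨⟨coeff m q, fun g => ?_⟩, rfl⟩
      have h1 := φ.injective ((hmap g q).symm.trans (hb g))
      conv_rhs => rw [← h1]
      simp [coeff_map]
    obtain ⟨r, hr⟩ := hq
    exact ⟨r, Subtype.ext ((hF r).trans (by rw [hr]))⟩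

/-- If `A ⊗ B` is a polynomial ring over `A` and `A` has a `k`-rational point, then `B` is a
polynomial ring over `k`. -/
theorem nonempty_algEquiv_of_retraction {ι : Type*} (ε : A →ₐ[k] k)
    (φ : MvPolynomial ι A ≃ₐ[A] (A ⊗[k] B)) : Nonempty (B ≃ₐ[k] MvPolynomial ι k) := by
  -- Base change of `φ` along `ε` turns `A ⊗ B` into `B`.
  let _ : Algebra A k := ε.toRingHom.toAlgebra
  have : IsScalarTower k A k := IsScalarTower.of_algebraMap_eq fun x => (ε.commutes x).symm
  let e1 : k ⊗[A] (A ⊗[k] B) ≃ₐ[k] k ⊗[k] B := Algebra.TensorProduct.cancelBaseChange k A k k B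
  let e2 : k ⊗[A] MvPolynomial ι A ≃ₐ[k] k ⊗[A] (A ⊗[k] B) :=
    Algebra.TensorProduct.congr AlgEquiv.refl φ
  exact ⟨(Algebra.TensorProduct.lid k B).symm.trans <| e1.symm.trans <| e2.symm.trans
    (algebraTensorAlgEquiv A k)⟩

end Coordinates

end GAlg

/-! ### Comparison of `Γ ⊗ P` with `P ⊗ Γ`. -/

theorem mainTheorem9 {k : Type u} {G : Type w} {Γ : Type v} (p n d : ℕ)
    [Fact p.Prime] [Field k] [CharP k p] [Group G] [Fintype G] (hG : Fintype.card G = p ^ n)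
    [CommRing Γ] [Algebra k Γ] (ρ : G →* (Γ ≃ₐ[k] Γ))
    (hΓ : GAlg.IsTs ρ) (hd : ringKrullDim Γ = d) (he : GAlg.IsErasable ρ) :
    Nonempty (Γ ≃ₐ[k] MvPolynomial (Fin d) k) ∧
    Nonempty ((GAlg.invariants ρ ⊗[k] MvPolynomial (Fin n) k) ≃ₐ[k]
      MvPolynomial (Fin (n + d)) k) ∧
    GAlg.IsStablyTriangular n ρ ∧
    GAlg.IsStablyPolynomial k n (GAlg.invariants ρ) := by
  open GAlg MvPolynomial in
  have hnt : Nontrivial Γ := by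
    by_contra h
    rw [not_nontrivial_iff_subsingleton] at h
    rw [ringKrullDim_eq_bot_of_subsingleton] at hd
    exact WithBot.bot_ne_coe hd
  obtain ⟨θ, hθ⟩ := hΓ.exists_trace_eq_one
  have := hΓ.finiteType
  have : IsNoetherianRing Γ := Algebra.FiniteType.isNoetherianRing k Γ
  obtain ⟨P, _, _, σ, hσ, ⟨η, hη⟩, ⟨eP⟩⟩ := exists_triangular_model k p n G hG
  obtain ⟨ψ, hψ⟩ := hσ.exists_invariant_coordinates ρ hθ
  obtain ⟨φ₀, -⟩ := id hσ
  have hP : IsTs σ := isTs_of_trace_eq_one (Algebra.FiniteType.equiv inferInstance φ₀) hη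
  obtain ⟨N, hN, he⟩ := he
  obtain rfl : N = d := by
    rw [hd] at hN
    exact_mod_cast hN.symm
  obtain ⟨φ, hφ⟩ := he P σ hP
  let c := Algebra.TensorProduct.comm k Γ P
  have hc : ∀ g a, c (tensor ρ σ g a) = tensor σ ρ g (c a) := fun g a => by
    induction a using TensorProduct.induction_on with
    | zero => simp
    | tmul a b => simp [c]
    | add a b ha hb => simp only [map_add, ha, hb]
  have hpoly : Nonempty ((invariants ρ ⊗[k] MvPolynomial (Fin n) k) ≃ₐ[k]
      MvPolynomial (Fin (n + N)) k) := by
    obtain ⟨e1⟩ := nonempty_mvPolynomial_invariants ψ (tensor_algebraMap ρ σ) hψ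
    obtain ⟨e2⟩ := nonempty_mvPolynomial_invariants φ (tensor_algebraMap σ ρ) hφ
    have hmap : (invariants (tensor ρ σ)).map (c : Γ ⊗[k] P →ₐ[k] P ⊗[k] Γ) =
        invariants (tensor σ ρ) := by
      ext a
      obtain ⟨a, rfl⟩ := c.surjective a
      simp [mem_invariants, Subalgebra.mem_map, ← hc]
    let e3 : invariants (tensor ρ σ) ≃ₐ[k] invariants (tensor σ ρ) :=
      (c.subalgebraMap _).trans (Subalgebra.equivOfEq _ _ hmap)
    have e0 : (invariants ρ ⊗[k] MvPolynomial (Fin n) k) ≃ₐ[k]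
        MvPolynomial (Fin n) (invariants ρ) :=
      (algebraTensorAlgEquiv k (invariants ρ)).restrictScalars k
    exact ⟨e0.trans <| e1.trans <| e3.trans <| e2.symm.trans <|
      (mapAlgEquiv (Fin N) eP).trans <|
      (sumAlgEquiv k (Fin N) (Fin n)).symm.trans <|
      renameEquiv k ((Equiv.sumComm (Fin N) (Fin n)).trans finSumFinEquiv)⟩
  -- The rational point of `P` is the origin in its polynomial coordinates.
  refine ⟨nonempty_algEquiv_of_retraction
    ((aeval (0 : Fin n → k)).comp (φ₀.symm : P →ₐ[k] MvPolynomial (Fin n) k)) φ, hpoly, ?_,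
    ⟨n + N, hpoly⟩⟩
  have ht : HasTriangularCoordinates (tensor σ ρ) (n + N) :=
    hσ.extend φ (tensor_algebraMap σ ρ) fun g j => ⟨0, by rw [hφ j g, sub_self, map_zero]⟩
  -- The fixed variables go to the invariant coordinates `ψ (X i)`, which makes `E` equivariant.
  let E : Γ ⊗[k] MvPolynomial (Fin n) k ≃ₐ[k] P ⊗[k] Γ :=
    (((algebraTensorAlgEquiv k Γ).trans ψ).restrictScalars k).trans c
  have hE : ∀ g a, E (tensor ρ 1 g a) = tensor σ ρ g (E a) := fun g a => by
    have h1 : ((E : Γ ⊗[k] MvPolynomial (Fin n) k →ₐ[k] P ⊗[k] Γ).comp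
        (tensor ρ 1 g : Γ ⊗[k] MvPolynomial (Fin n) k ≃ₐ[k] _).toAlgHom) =
        (tensor σ ρ g : P ⊗[k] Γ →ₐ[k] P ⊗[k] Γ).comp E := by
      refine Algebra.TensorProduct.ext (AlgHom.ext fun a => ?_) (MvPolynomial.algHom_ext fun i => ?_)
      · simp [E, c, TensorProduct.smul_tmul', Algebra.TensorProduct.one_def]
      · have h3 := hψ i g
        simp [E, ← hc, h3]
    exact DFunLike.congr_fun h1 a
  exact .of_hasTriangularCoordinates (injective_of_trace_eq_one hG hθ) <|
    ht.congr E.symm fun g a => E.injective (by simp [hE])
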